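/- Let $0<a<b$, $\sigma_1,\sigma_2>0$, $\varrho\in(-1,1)$, $\mathbf\Sigma=\begin{pmatrix}\sigma_1^2&\sigma_1\sigma_2\varrho\\ \sigma_1\sigma_2\varrho&\sigma_2^2\end{pmatrix}$, and let $\mathbf F:[a,b]\to\mathbb R^{p\times 2}$ be continuously differentiable with derivative $\dot{\mathbf F}$ (one-sided at the end points). Let $\boldsymbol\varepsilon=(\varepsilon_1,\varepsilon_2)^\top$ consist of two independent standard Brownian motions, let $\mathbf\Sigma^{1/2}$ be the positive semidefinite square root of $\mathbf\Sigma$, let $\theta\in\mathbb R^p$, and let $$\mathbf Y(t)=\mathbf F^\top(t)\theta+\mathbf\Sigma^{1/2}\boldsymbol\varepsilon(t),\qquad t\in[a,b].$$ Assume that the $p\times p$ matrix $$\mathbf M=\int_a^b\dot{\mathbf F}(t)\mathbf\Sigma^{-1}\dot{\mathbf F}^\top(t)\,dt+\tfrac1a\mathbf F(a)\mathbf\Sigma^{-1}\mathbf F^\top(a)$$ is non-singular, and denote by $$\hat\theta_{\rm BLUE}=\mathbf M^{-1}\Big(\int_a^b\dot{\mathbf F}(t)\mathbf\Sigma^{-1}\,d\mathbf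 Y(t)+\tfrac1a\mathbf F(a)\mathbf\Sigma^{-1}\mathbf Y(a)\Big)$$ the best linear unbiased estimator of $\theta$ in this continuous time model, where the integral is the stochastic (Wiener) integral of a deterministic integrand. For $n\ge2$, points $a=t_1<t_2<\dots<t_n=b$ and arbitrary $p\times2$ weight matrices $\mathbf\Phi_2,\dots,\mathbf\Phi_n$ let $$\hat\theta_n=\mathbf M^{-1}\Big\{\sum_{i=2}^n\mathbf\Phi_i\mathbf\Sigma^{-1}\big(\mathbf Y(t_i)-\mathbf Y(t_{i-1})\big)+\tfrac1a\mathbf F(a)\mathbf\Sigma^{-1}\mathbf Y(a)\Big\}.$$ Then the stochastic integral exists, the entries of $(\hat\theta_{\rm BLUE}-\hat\theta_n)(\hat\theta_{\rm BLUE}-\hat\theta_n)^\top$ are integrable, and \begin{align*} &\mathbb E_\theta\big[(\hat\theta_{\rm BLUE}-\hat\theta_n)(\hat\theta_{\rm BLUE}-\hat\theta_n)^\top\big] =\mathbf M^{-1}\Big\{\sum_{i=2}^n\int_{t_{i-1}}^{t_i}[\dot{\mathbf F}(s)-\mathbf\Phi_i]\mathbf\Sigma^{-1}[\dot{\mathbf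 F}(s)-\mathbf\Phi_i]^\top ds\\ &\quad+\sum_{i,j=2}^n\int_{t_{i-1}}^{t_i}[\dot{\mathbf F}(s)-\mathbf\Phi_i]\mathbf\Sigma^{-1}\dot{\mathbf F}^\top(s)\,ds\;\theta\theta^\top\int_{t_{j-1}}^{t_j}\dot{\mathbf F}(s)\mathbf\Sigma^{-1}[\dot{\mathbf F}(s)-\mathbf\Phi_j]^\top ds\Big\}\mathbf M^{-1}. \end{align*} -/

import Mathlib

open MeasureTheory ProbabilityTheory Filter Topology
open scoped Matrix NNReal ENNReal MatrixOrder

noncomputable section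

/-- A step function `∑ k, coef k * 1_{(node k, node (k + 1)]}` on the interval `[a, b]`. -/
structure StepFunction (a b : ℝ) where
  size : ℕ
  node : Fin (size + 1) → ℝ
  mono : Monotone node
  node_first : node 0 = a
  node_last : node (Fin.last size) = b
  coef : Fin size → ℝ

/-- The function `[a, b] → ℝ` described by a step function. -/
def StepFunction.toFun {a b : ℝ} (φ : StepFunction a b) (s : ℝ) : ℝ :=
  ∑ k : Fin φ.size,
    (Set.Ioc (φ.node k.castSucc) (φ.node k.succ)).indicator (fun _ => φ.coef k) s

/-- The elementary stochastic integral of a (deterministic) step function: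
`∑ k, coef k * (X (node (k + 1)) - X (node k))`. -/
def StepFunction.elemIntegral {a b : ℝ} (φ : StepFunction a b) {Ω : Type*}
    (X : ℝ → Ω → ℝ) (ω : Ω) : ℝ :=
  ∑ k : Fin φ.size, φ.coef k * (X (φ.node k.succ) ω - X (φ.node k.castSucc) ω)

/-- `I` is (a version of) the stochastic integral `∫_a^b g(s) dX(s)` of the deterministic square
integrable function `g` with respect to the process `X`: whenever step functions converge to `g`
in `L²([a, b])`, their elementary integrals converge to `I` in `L²(P)`. -/
def IsStochIntegral {Ω : Type*} [MeasurableSpace Ω] (P : Measure Ω) (X : ℝ → Ω → ℝ)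
    (a b : ℝ) (g : ℝ → ℝ) (I : Ω → ℝ) : Prop :=
  MemLp g 2 (volume.restrict (Set.Icc a b)) ∧ MemLp I 2 P ∧
    ∀ φ : ℕ → StepFunction a b,
      Tendsto (fun k => eLpNorm (fun s => (φ k).toFun s - g s) 2
        (volume.restrict (Set.Icc a b))) atTop (𝓝 0) →
      Tendsto (fun k => eLpNorm (fun ω => (φ k).elemIntegral X ω - I ω) 2 P) atTop (𝓝 0)

open Classical in
/-- The stochastic integral `∫_a^b g(s) dX(s)`, a random variable (a version of it is chosen;
the value is `0` if the integral does not exist). -/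
def stochIntegral {Ω : Type*} [MeasurableSpace Ω] (P : Measure Ω) (X : ℝ → Ω → ℝ)
    (a b : ℝ) (g : ℝ → ℝ) : Ω → ℝ :=
  if h : ∃ I : Ω → ℝ, IsStochIntegral P X a b g I then h.choose else 0

/-- The entrywise integral `∫_a^b G(s) ds` of a matrix valued function. -/
def matIntegral {m n : Type*} (a b : ℝ) (G : ℝ → Matrix m n ℝ) : Matrix m n ℝ :=
  Matrix.of fun r c => ∫ s in a..b, G s r c

/-- The entrywise derivative of `F` on the interval `[a, b]` (one-sided at the end points). -/
def matDeriv {p : ℕ} (a b : ℝ) (F : ℝ → Matrix (Fin p) (Fin 2) ℝ) (s : ℝ) :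
    Matrix (Fin p) (Fin 2) ℝ :=
  Matrix.of fun r c => derivWithin (fun u => F u r c) (Set.Icc a b) s

/-- The covariance matrix of the two groups, with standard deviations `σ₁`, `σ₂` and
correlation `ρ`. -/
def covMatrix (σ₁ σ₂ ρ : ℝ) : Matrix (Fin 2) (Fin 2) ℝ :=
  !![σ₁ ^ 2, σ₁ * σ₂ * ρ; σ₁ * σ₂ * ρ, σ₂ ^ 2]

/-- The observed process `Y(t) = Fᵀ(t) θ + S^{1/2} ε(t)`, with `S^{1/2}` the positive semidefinite
square root of `S`. -/
def observation {p : ℕ} {Ω : Type*} (F : ℝ → Matrix (Fin p) (Fin 2) ℝ)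
    (S : Matrix (Fin 2) (Fin 2) ℝ) (ε : Fin 2 → ℝ≥0 → Ω → ℝ) (θ : Fin p → ℝ)
    (t : ℝ) (ω : Ω) : Fin 2 → ℝ :=
  (F t)ᵀ *ᵥ θ + CFC.sqrt S *ᵥ (fun c => ε c t.toNNReal ω)

/-- `M = ∫_a^b Ḟ(t) S⁻¹ Ḟᵀ(t) dt + (1/a) F(a) S⁻¹ Fᵀ(a)`. -/
def infoMatrix {p : ℕ} (a b : ℝ) (F : ℝ → Matrix (Fin p) (Fin 2) ℝ)
    (S : Matrix (Fin 2) (Fin 2) ℝ) : Matrix (Fin p) (Fin p) ℝ :=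
  matIntegral a b (fun s => matDeriv a b F s * S⁻¹ * (matDeriv a b F s)ᵀ)
    + (1 / a) • (F a * S⁻¹ * (F a)ᵀ)

/-- The best linear unbiased estimator in the continuous time model,
`M⁻¹ (∫_a^b Ḟ(t) S⁻¹ dY(t) + (1/a) F(a) S⁻¹ Y(a))`. -/
def blue {p : ℕ} {Ω : Type*} [MeasurableSpace Ω] (P : Measure Ω) (a b : ℝ)
    (F : ℝ → Matrix (Fin p) (Fin 2) ℝ) (S : Matrix (Fin 2) (Fin 2) ℝ)
    (Y : ℝ → Ω → Fin 2 → ℝ) (ω : Ω) : Fin p → ℝ :=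
  (infoMatrix a b F S)⁻¹ *ᵥ
    ((fun r => ∑ c : Fin 2,
        stochIntegral P (fun t ω' => Y t ω' c) a b (fun s => (matDeriv a b F s * S⁻¹) r c) ω)
      + (1 / a) • ((F a * S⁻¹) *ᵥ Y a ω))

/-- The discrete approximation with design points `t 0 < ⋯ < t m` and weights `Φ`,
`M⁻¹ (∑ i, Φ i S⁻¹ (Y(t (i + 1)) - Y(t i)) + (1/a) F(a) S⁻¹ Y(a))`. -/
def discreteEstimator {p m : ℕ} {Ω : Type*} (a b : ℝ)
    (F : ℝ → Matrix (Fin p) (Fin 2) ℝ) (S : Matrix (Fin 2) (Fin 2) ℝ)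
    (t : Fin (m + 1) → ℝ) (Φ : Fin m → Matrix (Fin p) (Fin 2) ℝ)
    (Y : ℝ → Ω → Fin 2 → ℝ) (ω : Ω) : Fin p → ℝ :=
  (infoMatrix a b F S)⁻¹ *ᵥ
    ((∑ i : Fin m, (Φ i * S⁻¹) *ᵥ (Y (t i.succ) ω - Y (t i.castSucc) ω))
      + (1 / a) • ((F a * S⁻¹) *ᵥ Y a ω))

end

/-! The term of the estimators at time `a` cancels, so their difference is `M⁻¹ V`, where `V` is the
integral against `dY` of `ψ = (Ḟ - Φ i) S⁻¹` on the i-th cell. As `dY = Ḟᵀ θ ds + S^{1/2} dε`, `V`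
is a constant drift `W θ`, with `W` the sum of the integrals of `(Ḟ - Φ i) S⁻¹ Ḟᵀ`, plus a centred
noise part. The mixed terms have mean zero, hence `E[V Vᵀ] = W θ θᵀ Wᵀ + E[noise noiseᵀ]`. The noise
has covariance `S min(s, t)`, so the Itô isometry gives the last term as the integral of `ψ S ψᵀ =
(Ḟ - Φ i) S⁻¹ (Ḟ - Φ i)ᵀ`. Symmetry of `M` turns `M⁻¹ (·) (M⁻¹)ᵀ` into the stated form.

Only first and second moments of the noise matter. The isometry for step functions
(`integral_elemIntegral_mul_elemIntegral`) makes the elementary integral Lipschitz in `L²`.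
Completeness and density then give existence (`exists_isStochIntegral`), and passing to the limit
gives `integral_sub_elemIntegral_mul`. Everything is assembled in `integral_integralError_mul`. -/

/-! ### `L²` pairings and limits -/

section L2

variable {α : Type*} {mα : MeasurableSpace α} {μ : Measure α}

theorem inner_toLp_toLp_eq_integral {f g : α → ℝ} (hf : MemLp f 2 μ) (hg : MemLp g 2 μ) :
    inner ℝ (hf.toLp f) (hg.toLp g) = ∫ x, f x * g x ∂μ := by
  rw [L2.inner_def]
  refine integral_congr_ae ?_
  filter_upwards [hf.coeFn_toLp, hg.coeFn_toLp] with x hx hy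
  simp [hx, hy, mul_comm]

theorem dist_toLp_toLp_sq {f g : α → ℝ} (hf : MemLp f 2 μ) (hg : MemLp g 2 μ) :
    dist (hf.toLp f) (hg.toLp g) ^ 2 = ∫ x, (f x - g x) * (f x - g x) ∂μ := by
  rw [dist_eq_norm, ← MemLp.toLp_sub, ← real_inner_self_eq_norm_sq, inner_toLp_toLp_eq_integral]
  rfl

theorem integral_sub_mul_sub {f₁ f₂ g₁ g₂ : α → ℝ} (hf₁ : MemLp f₁ 2 μ) (hf₂ : MemLp f₂ 2 μ)
    (hg₁ : MemLp g₁ 2 μ) (hg₂ : MemLp g₂ 2 μ) :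
    ∫ x, (f₁ x - f₂ x) * (g₁ x - g₂ x) ∂μ =
      ∫ x, f₁ x * g₁ x ∂μ - ∫ x, f₁ x * g₂ x ∂μ
        - (∫ x, f₂ x * g₁ x ∂μ - ∫ x, f₂ x * g₂ x ∂μ) := by
  have h11 : Integrable (fun x => f₁ x * g₁ x) μ := hf₁.integrable_mul hg₁
  have h12 : Integrable (fun x => f₁ x * g₂ x) μ := hf₁.integrable_mul hg₂
  have h21 : Integrable (fun x => f₂ x * g₁ x) μ := hf₂.integrable_mul hg₁
  have h22 : Integrable (fun x => f₂ x * g₂ x) μ := hf₂.integrable_mul hg₂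
  have h1 : Integrable (fun x => f₁ x * g₁ x - f₂ x * g₁ x) μ := h11.sub h21
  have h2 : Integrable (fun x => f₁ x * g₂ x - f₂ x * g₂ x) μ := h12.sub h22
  simp only [sub_mul, mul_sub]
  rw [integral_sub h1 h2, integral_sub h11 h21, integral_sub h12 h22]
  ring

/-- The `L²` pairing is continuous along `L²`-convergent sequences. -/
theorem tendsto_integral_mul_of_tendsto_eLpNorm {f g : ℕ → α → ℝ} {f₀ g₀ : α → ℝ}
    (hf : ∀ n, MemLp (f n) 2 μ) (hf₀ : MemLp f₀ 2 μ) (hg : ∀ n, MemLp (g n) 2 μ)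
    (hg₀ : MemLp g₀ 2 μ) (hfl : Tendsto (fun n => eLpNorm (fun x => f n x - f₀ x) 2 μ) atTop (𝓝 0))
    (hgl : Tendsto (fun n => eLpNorm (fun x => g n x - g₀ x) 2 μ) atTop (𝓝 0)) :
    Tendsto (fun n => ∫ x, f n x * g n x ∂μ) atTop (𝓝 (∫ x, f₀ x * g₀ x ∂μ)) := by
  have h1 := (Lp.tendsto_Lp_iff_tendsto_eLpNorm'' f hf f₀ hf₀).2 hfl
  have h2 := (Lp.tendsto_Lp_iff_tendsto_eLpNorm'' g hg g₀ hg₀).2 hgl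
  simpa only [inner_toLp_toLp_eq_integral] using h1.inner (𝕜 := ℝ) h2

theorem ae_eq_of_tendsto_eLpNorm_sub {f : ℕ → α → ℝ} {g h : α → ℝ}
    (hf : ∀ n, MemLp (f n) 2 μ) (hg : MemLp g 2 μ) (hh : MemLp h 2 μ)
    (hgl : Tendsto (fun n => eLpNorm (fun x => f n x - g x) 2 μ) atTop (𝓝 0))
    (hhl : Tendsto (fun n => eLpNorm (fun x => f n x - h x) 2 μ) atTop (𝓝 0)) : g =ᵐ[μ] h := by
  have h1 := (Lp.tendsto_Lp_iff_tendsto_eLpNorm'' f hf g hg).2 hgl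
  have h2 := (Lp.tendsto_Lp_iff_tendsto_eLpNorm'' f hf h hh).2 hhl
  exact (MemLp.toLp_eq_toLp_iff hg hh).1 (tendsto_nhds_unique h1 h2)

/-- A map whose distances are a multiple of those of `u` has a limit along `u → x`. -/
theorem exists_tendsto_comap_of_dist_le {ι E G : Type*} [PseudoMetricSpace E] [PseudoMetricSpace G]
    [CompleteSpace G] {u : ι → E} {v : ι → G} {C : ℝ}
    (h : ∀ i j, dist (v i) (v j) ≤ C * dist (u i) (u j)) {x : E}
    (hx : x ∈ closure (Set.range u)) : ∃ y, Tendsto v (comap u (𝓝 x)) (𝓝 y) := by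
  -- Membership of `x` in the closure is exactly what makes this filter nontrivial; the distance
  -- bound then makes its image under `v` Cauchy.
  have : (comap u (𝓝 x)).NeBot := by
    rw [comap_neBot_iff]
    intro s hs
    obtain ⟨_, hz, i, rfl⟩ := mem_closure_iff_nhds.1 hx s hs
    exact ⟨i, hz⟩
  refine cauchy_map_iff_exists_tendsto.1 ⟨inferInstance, ?_⟩
  have hu : Tendsto (fun p : ι × ι => C * dist (u p.1) (u p.2))
      (comap u (𝓝 x) ×ˢ comap u (𝓝 x)) (𝓝 0) := by
    have := (tendsto_comap (f := u) (x := 𝓝 x)).comp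
      (tendsto_fst (f := comap u (𝓝 x)) (g := comap u (𝓝 x)))
    have h2 := (tendsto_comap (f := u) (x := 𝓝 x)).comp
      (tendsto_snd (f := comap u (𝓝 x)) (g := comap u (𝓝 x)))
    simpa using (this.dist h2).const_mul C
  rw [prod_map_map_eq, Metric.uniformity_eq_comap_nhds_zero, ← tendsto_iff_comap, tendsto_map'_iff]
  exact squeeze_zero (fun _ => dist_nonneg) (fun p => h p.1 p.2) hu

end L2

/-! ### Step functions and their elementary integrals -/

namespace StepFunction

variable {a b : ℝ} (φ : StepFunction a b)

theorem node_mem_Icc (i : Fin (φ.size + 1)) : φ.node i ∈ Set.Icc a b := by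
  have h1 := φ.mono (Fin.zero_le i)
  have h2 := φ.mono (Fin.le_last i)
  rw [φ.node_first] at h1
  rw [φ.node_last] at h2
  exact ⟨h1, h2⟩

theorem node_le (k : Fin φ.size) : φ.node k.castSucc ≤ φ.node k.succ :=
  φ.mono k.castSucc_lt_succ.le

/-- Monotone nodes make the half-open cells pairwise disjoint; repeated nodes only give empty cells.
-/
theorem toFun_eq_coef {k : Fin φ.size} {s : ℝ}
    (hs : s ∈ Set.Ioc (φ.node k.castSucc) (φ.node k.succ)) : φ.toFun s = φ.coef k := by
  rw [toFun, Finset.sum_eq_single k, Set.indicator_of_mem hs]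
  · intro l _ hl
    refine Set.indicator_of_notMem (fun h => ?_) _
    rcases lt_or_gt_of_ne hl with h' | h'
    · have := φ.mono (show l.succ ≤ k.castSucc from Fin.succ_le_castSucc_iff.2 h')
      exact absurd (hs.1.trans_le h.2) this.not_gt
    · have := φ.mono (show k.succ ≤ l.castSucc from Fin.succ_le_castSucc_iff.2 h')
      exact absurd (h.1.trans_le hs.2) this.not_gt
  · simp

/-- If no cell contained `s`, induction would keep every node strictly below `s`, including the last
one, `b`. The point `a` lies in no cell, which is harmless as it is null. -/
theorem exists_mem_Ioc {s : ℝ} (hs : s ∈ Set.Ioc a b) :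
    ∃ k : Fin φ.size, s ∈ Set.Ioc (φ.node k.castSucc) (φ.node k.succ) := by
  by_contra! h
  have key : ∀ i : Fin (φ.size + 1), φ.node i < s := by
    intro i
    induction i using Fin.induction with
    | zero => rw [φ.node_first]; exact hs.1
    | succ k ih => exact lt_of_not_ge fun h' => h k ⟨ih, h'⟩
  have := key (Fin.last _)
  rw [φ.node_last] at this
  exact absurd hs.2 this.not_ge

theorem memLp_toFun : MemLp φ.toFun 2 (volume.restrict (Set.Icc a b)) := by
  have : φ.toFun = ∑ k : Fin φ.size, (Set.Ioc (φ.node k.castSucc) (φ.node k.succ)).indicator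
      (fun _ => φ.coef k) := by
    ext s; simp [toFun]
  rw [this]
  exact memLp_finsetSum' _ fun k _ => memLp_indicator_const 2 measurableSet_Ioc _
    (Or.inr (measure_ne_top _ _))

theorem integral_toFun_mul {f : ℝ → ℝ} (hf : IntegrableOn f (Set.Icc a b)) :
    ∫ s in Set.Icc a b, φ.toFun s * f s =
      ∑ k : Fin φ.size, φ.coef k * ∫ s in φ.node k.castSucc..φ.node k.succ, f s := by
  have h1 : ∀ k : Fin φ.size, ∀ s,
      (Set.Ioc (φ.node k.castSucc) (φ.node k.succ)).indicator (fun _ => φ.coef k) s * f s =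
      (Set.Ioc (φ.node k.castSucc) (φ.node k.succ)).indicator (fun s => φ.coef k * f s) s := by
    intro k s
    by_cases h : s ∈ Set.Ioc (φ.node k.castSucc) (φ.node k.succ) <;> simp [h]
  simp only [toFun, Finset.sum_mul, h1]
  rw [integral_finsetSum]
  · refine Finset.sum_congr rfl fun k _ => ?_
    rw [setIntegral_indicator measurableSet_Ioc, intervalIntegral.integral_of_le (φ.node_le k),
      ← integral_const_mul]
    congr 2
    refine Set.inter_eq_right.2 fun s hs => ?_
    exact ⟨(φ.node_mem_Icc _).1.trans hs.1.le, hs.2.trans (φ.node_mem_Icc _).2⟩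
  · intro k _
    exact (hf.const_mul _).indicator measurableSet_Ioc

theorem integral_Icc_eq_sum {f : ℝ → ℝ} (hf : IntegrableOn f (Set.Icc a b)) :
    ∫ s in Set.Icc a b, f s =
      ∑ k : Fin φ.size, ∫ s in φ.node k.castSucc..φ.node k.succ, f s := by
  -- With all coefficients 1 on the same nodes, the step function is the indicator of `(a, b]`.
  let ψ : StepFunction a b := { φ with coef := fun _ => 1 }
  have h := ψ.integral_toFun_mul hf
  simp only [ψ, one_mul] at h
  rw [← h, integral_Icc_eq_integral_Ioc, integral_Icc_eq_integral_Ioc]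
  refine setIntegral_congr_fun measurableSet_Ioc fun s hs => ?_
  obtain ⟨k, hk⟩ := ψ.exists_mem_Ioc hs
  have := ψ.toFun_eq_coef hk
  simp only [ψ] at this
  simp [this]

variable {Ω : Type*} {mΩ : MeasurableSpace Ω} {P : Measure Ω}

theorem memLp_elemIntegral {X : ℝ → Ω → ℝ} (hX : ∀ t ∈ Set.Icc a b, MemLp (X t) 2 P) :
    MemLp (φ.elemIntegral X) 2 P := by
  have : φ.elemIntegral X = ∑ k : Fin φ.size,
      fun ω => φ.coef k * (X (φ.node k.succ) ω - X (φ.node k.castSucc) ω) := by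
    ext ω; simp [elemIntegral]
  rw [this]
  exact memLp_finsetSum' _ fun k _ =>
    ((hX _ (φ.node_mem_Icc _)).sub (hX _ (φ.node_mem_Icc _))).const_mul _

theorem integral_elemIntegral_eq_zero [IsFiniteMeasure P] {X : ℝ → Ω → ℝ}
    (hX : ∀ t ∈ Set.Icc a b, MemLp (X t) 2 P) (h0 : ∀ t ∈ Set.Icc a b, ∫ ω, X t ω ∂P = 0) :
    ∫ ω, φ.elemIntegral X ω ∂P = 0 := by
  have hi : ∀ i, Integrable (X (φ.node i)) P := fun i =>
    (hX _ (φ.node_mem_Icc i)).integrable (by norm_num)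
  simp only [elemIntegral]
  have hint : ∀ k : Fin φ.size, Integrable (fun ω =>
      φ.coef k * (X (φ.node k.succ) ω - X (φ.node k.castSucc) ω)) P := fun k =>
    ((hi _).sub (hi _)).const_mul _
  rw [integral_finsetSum _ fun k _ => hint k]
  refine Finset.sum_eq_zero fun k _ => ?_
  rw [integral_const_mul, integral_sub (hi _) (hi _), h0 _ (φ.node_mem_Icc _),
    h0 _ (φ.node_mem_Icc _)]
  simp

/-- The length of the intersection of two cells is a mixed second difference of `min`, the same
expression that the covariance `min s t` produces for products of increments. -/
theorem integral_toFun_mul_toFun (ψ : StepFunction a b) :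
    ∫ s in Set.Icc a b, φ.toFun s * ψ.toFun s =
      ∑ k : Fin φ.size, ∑ l : Fin ψ.size, φ.coef k * ψ.coef l *
        (min (φ.node k.succ) (ψ.node l.succ) - min (φ.node k.succ) (ψ.node l.castSucc)
          - min (φ.node k.castSucc) (ψ.node l.succ)
          + min (φ.node k.castSucc) (ψ.node l.castSucc)) := by
  rw [φ.integral_toFun_mul (ψ.memLp_toFun.integrable (by norm_num))]
  refine Finset.sum_congr rfl fun k _ => ?_
  rw [intervalIntegral.integral_of_le (φ.node_le k)]
  simp only [toFun]
  rw [integral_finsetSum, Finset.mul_sum]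
  · refine Finset.sum_congr rfl fun l _ => ?_
    rw [setIntegral_indicator measurableSet_Ioc, Set.Ioc_inter_Ioc, setIntegral_const, mul_assoc,
      Real.volume_real_Ioc, smul_eq_mul, mul_comm (max _ _)]
    congr 2
    have h1 := φ.node_le k
    have h2 := ψ.node_le l
    grind
  · intro l _
    exact (integrable_const _).indicator measurableSet_Ioc

/-- Itô isometry for step functions and a pair of processes with covariance `κ * min s t`. -/
theorem integral_elemIntegral_mul_elemIntegral (ψ : StepFunction a b) {X X' : ℝ → Ω → ℝ} {κ : ℝ}
    (hX : ∀ t ∈ Set.Icc a b, MemLp (X t) 2 P) (hX' : ∀ t ∈ Set.Icc a b, MemLp (X' t) 2 P)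
    (hcov : ∀ s ∈ Set.Icc a b, ∀ t ∈ Set.Icc a b, ∫ ω, X s ω * X' t ω ∂P = κ * min s t) :
    ∫ ω, φ.elemIntegral X ω * ψ.elemIntegral X' ω ∂P =
      κ * ∫ s in Set.Icc a b, φ.toFun s * ψ.toFun s := by
  have hi : ∀ i j, Integrable (fun ω => X (φ.node i) ω * X' (ψ.node j) ω) P := fun i j =>
    (hX _ (φ.node_mem_Icc i)).integrable_mul (hX' _ (ψ.node_mem_Icc j))
  have hE : ∀ k l, ∀ ω, (φ.coef k * (X (φ.node k.succ) ω - X (φ.node k.castSucc) ω)) *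
      (ψ.coef l * (X' (ψ.node l.succ) ω - X' (ψ.node l.castSucc) ω)) =
      φ.coef k * ψ.coef l * (X (φ.node k.succ) ω * X' (ψ.node l.succ) ω
        - X (φ.node k.succ) ω * X' (ψ.node l.castSucc) ω
        - X (φ.node k.castSucc) ω * X' (ψ.node l.succ) ω
        + X (φ.node k.castSucc) ω * X' (ψ.node l.castSucc) ω) := by
    intros; ring
  have hint : ∀ k l, Integrable (fun ω =>
      φ.coef k * ψ.coef l * (X (φ.node k.succ) ω * X' (ψ.node l.succ) ω
        - X (φ.node k.succ) ω * X' (ψ.node l.castSucc) ω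
        - X (φ.node k.castSucc) ω * X' (ψ.node l.succ) ω
        + X (φ.node k.castSucc) ω * X' (ψ.node l.castSucc) ω)) P := fun k l =>
    ((((hi _ _).sub (hi _ _)).sub (hi _ _)).add (hi _ _)).const_mul _
  simp only [elemIntegral, Finset.sum_mul_sum, hE]
  rw [integral_finsetSum _ fun k _ => integrable_finsetSum _ fun l _ => hint k l,
    integral_toFun_mul_toFun, Finset.mul_sum]
  refine Finset.sum_congr rfl fun k _ => ?_
  rw [integral_finsetSum _ fun l _ => hint k l, Finset.mul_sum]
  refine Finset.sum_congr rfl fun l _ => ?_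
  rw [integral_const_mul, integral_add, integral_sub, integral_sub (hi _ _) (hi _ _)]
  · simp only [hcov _ (φ.node_mem_Icc _) _ (ψ.node_mem_Icc _)]
    ring
  · exact (hi _ _).sub (hi _ _)
  · exact hi _ _
  · exact ((hi _ _).sub (hi _ _)).sub (hi _ _)
  · exact hi _ _

theorem elemIntegral_add (X X' : ℝ → Ω → ℝ) (ω : Ω) :
    φ.elemIntegral (fun t ω => X t ω + X' t ω) ω =
      φ.elemIntegral X ω + φ.elemIntegral X' ω := by
  simp only [elemIntegral, ← Finset.sum_add_distrib]
  exact Finset.sum_congr rfl fun _ _ => by ring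

theorem elemIntegral_deterministic {h h' : ℝ → ℝ} (hh' : IntegrableOn h' (Set.Icc a b))
    (hftc : ∀ u ∈ Set.Icc a b, ∀ v ∈ Set.Icc a b, u ≤ v → ∫ s in u..v, h' s = h v - h u)
    (ω : Ω) :
    φ.elemIntegral (fun t _ => h t) ω = ∫ s in Set.Icc a b, φ.toFun s * h' s := by
  rw [φ.integral_toFun_mul hh', elemIntegral]
  refine Finset.sum_congr rfl fun i _ => ?_
  rw [hftc _ (φ.node_mem_Icc _) _ (φ.node_mem_Icc _) (φ.node_le i)]

/-- Uniform continuity on a uniform grid of mesh at most `η`, sampling `g` at the right end of each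
cell. The bound omits `a`, where every step function vanishes. -/
theorem exists_toFun_sub_le (hab : a < b) {g : ℝ → ℝ} (hg : ContinuousOn g (Set.Icc a b)) {δ : ℝ}
    (hδ : 0 < δ) : ∃ φ : StepFunction a b, ∀ s ∈ Set.Ioc a b, |φ.toFun s - g s| ≤ δ := by
  obtain ⟨η, hη, h⟩ := Metric.uniformContinuousOn_iff_le.1
    (isCompact_Icc.uniformContinuousOn_of_continuous hg) δ hδ
  obtain ⟨n, hn⟩ := exists_nat_gt ((b - a) / η)
  have hn0 : (0 : ℝ) < n := (div_pos (sub_pos.2 hab) hη).trans hn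
  have hstep : (b - a) / n ≤ η := by
    rw [div_lt_iff₀ hη] at hn
    rw [div_le_iff₀ hn0]
    linarith
  let φ : StepFunction a b :=
    { size := n
      node := fun i => a + (b - a) / n * (i : ℕ)
      mono := fun i j hij => by
        have : ((i : ℕ) : ℝ) ≤ (j : ℕ) := by exact_mod_cast hij
        have h0 : 0 ≤ (b - a) / n := div_nonneg (sub_pos.2 hab).le hn0.le
        dsimp only
        gcongr
      node_first := by simp
      node_last := by
        simp only [Fin.val_last]
        field_simp
        ring
      coef := fun k => g (a + (b - a) / n * ((k : ℕ) + 1)) }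
  refine ⟨φ, fun s hs => ?_⟩
  obtain ⟨k, hk⟩ := φ.exists_mem_Ioc hs
  rw [φ.toFun_eq_coef hk, ← Real.dist_eq]
  have hm := φ.node_mem_Icc k.succ
  simp only [φ, Fin.val_succ, Fin.val_castSucc, Nat.cast_add, Nat.cast_one] at hm hk ⊢
  refine h _ hm _ ⟨hs.1.le, hs.2⟩ ?_
  rw [Real.dist_eq, abs_le]
  constructor <;> nlinarith [hk.1, hk.2]

theorem exists_eLpNorm_sub_le (hab : a < b) {g : ℝ → ℝ} (hg : ContinuousOn g (Set.Icc a b))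
    {δ : ℝ} (hδ : 0 < δ) : ∃ φ : StepFunction a b,
      eLpNorm (fun s => φ.toFun s - g s) 2 (volume.restrict (Set.Icc a b)) ≤ ENNReal.ofReal δ := by
  -- This `c` dominates the square root of `b - a`, so the uniform bound `δ / c` yields the `L²`
  -- bound `δ`.
  set c : ℝ := max 1 (b - a) with hc
  have hc1 : 1 ≤ c := le_max_left _ _
  obtain ⟨φ, hφ⟩ := exists_toFun_sub_le hab hg (div_pos hδ (zero_lt_one.trans_le hc1))
  refine ⟨φ, ?_⟩
  have hae : ∀ᵐ s ∂(volume.restrict (Set.Icc a b)), ‖φ.toFun s - g s‖ ≤ δ / c := by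
    rw [← restrict_Ioc_eq_restrict_Icc]
    exact (ae_restrict_iff' measurableSet_Ioc).2 (.of_forall hφ)
  refine (eLpNorm_le_of_ae_bound hae).trans ?_
  have h2 : (volume.restrict (Set.Icc a b)) Set.univ ^ ((2 : ℝ≥0∞).toReal)⁻¹ ≤
      ENNReal.ofReal c := by
    rw [Measure.restrict_apply_univ, Real.volume_Icc]
    calc ENNReal.ofReal (b - a) ^ ((2 : ℝ≥0∞).toReal)⁻¹
        ≤ ENNReal.ofReal c ^ ((2 : ℝ≥0∞).toReal)⁻¹ := by
          gcongr
          exact le_max_right _ _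
      _ ≤ ENNReal.ofReal c ^ (1 : ℝ) := by
          refine ENNReal.rpow_le_rpow_of_exponent_le (by simpa using hc1) ?_
          norm_num
      _ = ENNReal.ofReal c := ENNReal.rpow_one _
  calc _ ≤ ENNReal.ofReal c * ENNReal.ofReal (δ / c) := by gcongr
    _ = ENNReal.ofReal δ := by
      rw [← ENNReal.ofReal_mul (by linarith)]
      congr 1
      field_simp

theorem exists_tendsto_eLpNorm_sub (hab : a < b) {g : ℝ → ℝ} (hg : ContinuousOn g (Set.Icc a b)) :
    ∃ φ : ℕ → StepFunction a b, Tendsto (fun k => eLpNorm (fun s => (φ k).toFun s - g s) 2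
        (volume.restrict (Set.Icc a b))) atTop (𝓝 0) := by
  choose φ hφ using fun k : ℕ => exists_eLpNorm_sub_le hab hg (Nat.one_div_pos_of_nat (n := k))
  refine ⟨φ, tendsto_of_tendsto_of_tendsto_of_le_of_le tendsto_const_nhds ?_ (fun _ => zero_le)
    hφ⟩
  simpa using ENNReal.tendsto_ofReal (tendsto_one_div_add_atTop_nhds_zero_nat (𝕜 := ℝ))

end StepFunction

/-! ### The Wiener integral: existence, uniqueness and isometry -/

section StochIntegral

variable {a b : ℝ} {Ω : Type*} {mΩ : MeasurableSpace Ω} {P : Measure Ω}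

/-- Itô isometry for differences of step functions. -/
theorem StepFunction.integral_elemIntegral_sub_mul_sub (φ₁ φ₂ ψ₁ ψ₂ : StepFunction a b)
    {X X' : ℝ → Ω → ℝ} {κ : ℝ}
    (hX : ∀ t ∈ Set.Icc a b, MemLp (X t) 2 P) (hX' : ∀ t ∈ Set.Icc a b, MemLp (X' t) 2 P)
    (hcov : ∀ s ∈ Set.Icc a b, ∀ t ∈ Set.Icc a b, ∫ ω, X s ω * X' t ω ∂P = κ * min s t) :
    ∫ ω, (φ₁.elemIntegral X ω - φ₂.elemIntegral X ω) *
        (ψ₁.elemIntegral X' ω - ψ₂.elemIntegral X' ω) ∂P =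
      κ * ∫ s in Set.Icc a b, (φ₁.toFun s - φ₂.toFun s) * (ψ₁.toFun s - ψ₂.toFun s) := by
  rw [integral_sub_mul_sub (φ₁.memLp_elemIntegral hX) (φ₂.memLp_elemIntegral hX)
      (ψ₁.memLp_elemIntegral hX') (ψ₂.memLp_elemIntegral hX'),
    integral_sub_mul_sub φ₁.memLp_toFun φ₂.memLp_toFun ψ₁.memLp_toFun ψ₂.memLp_toFun]
  simp only [integral_elemIntegral_mul_elemIntegral _ _ hX hX' hcov]
  ring

/-- The Wiener integral of a continuous function exists. -/
theorem exists_isStochIntegral (hab : a < b) {X : ℝ → Ω → ℝ} {κ : ℝ}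
    (hX : ∀ t ∈ Set.Icc a b, MemLp (X t) 2 P)
    (hcov : ∀ s ∈ Set.Icc a b, ∀ t ∈ Set.Icc a b, ∫ ω, X s ω * X t ω ∂P = κ * min s t)
    {g : ℝ → ℝ} (hg : ContinuousOn g (Set.Icc a b))
    (hgm : MemLp g 2 (volume.restrict (Set.Icc a b))) : ∃ I, IsStochIntegral P X a b g I := by
  let u : StepFunction a b → Lp ℝ 2 (volume.restrict (Set.Icc a b)) :=
    fun φ => φ.memLp_toFun.toLp φ.toFun
  let v : StepFunction a b → Lp ℝ 2 P :=
    fun φ => (φ.memLp_elemIntegral hX).toLp (φ.elemIntegral X)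
  have hu : ∀ φ : ℕ → StepFunction a b,
      Tendsto (fun k => eLpNorm (fun s => (φ k).toFun s - g s) 2
        (volume.restrict (Set.Icc a b))) atTop (𝓝 0) →
      Tendsto (fun k => u (φ k)) atTop (𝓝 (hgm.toLp g)) := fun φ h =>
    (Lp.tendsto_Lp_iff_tendsto_eLpNorm'' (fun k => (φ k).toFun) (fun k => (φ k).memLp_toFun)
      g hgm).2 h
  -- The isometry gives squared distances scaled by `κ`; the absolute value avoids a sign
  -- hypothesis.
  have hdist : ∀ φ ψ, dist (v φ) (v ψ) ≤ √|κ| * dist (u φ) (u ψ) := by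
    intro φ ψ
    refine le_of_sq_le_sq ?_ (by positivity)
    rw [mul_pow, Real.sq_sqrt (abs_nonneg _), dist_toLp_toLp_sq,
      StepFunction.integral_elemIntegral_sub_mul_sub φ ψ φ ψ hX hX hcov, ← dist_toLp_toLp_sq
        φ.memLp_toFun ψ.memLp_toFun]
    exact mul_le_mul_of_nonneg_right (le_abs_self κ) (sq_nonneg _)
  have hcl : hgm.toLp g ∈ closure (Set.range u) := by
    obtain ⟨φ, hφ⟩ := StepFunction.exists_tendsto_eLpNorm_sub hab hg
    exact mem_closure_of_tendsto (hu φ hφ) (.of_forall fun k => ⟨φ k, rfl⟩)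
  obtain ⟨y, hy⟩ := exists_tendsto_comap_of_dist_le hdist hcl
  refine ⟨y, hgm, Lp.memLp y, fun φ hφ => ?_⟩
  -- The limit is taken along the filter of all approximations of `g`, so one `y` serves every
  -- sequence.
  have h1 : Tendsto (fun k => v (φ k)) atTop (𝓝 y) := hy.comp (tendsto_comap_iff.2 (hu φ hφ))
  refine (Lp.tendsto_Lp_iff_tendsto_eLpNorm'' (fun k => (φ k).elemIntegral X)
    (fun k => (φ k).memLp_elemIntegral hX) y (Lp.memLp y)).1 ?_
  simpa using h1

/-- The integral with respect to a deterministic absolutely continuous integrator. -/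
theorem isStochIntegral_deterministic [IsFiniteMeasure P] {h h' g : ℝ → ℝ}
    (hh' : MemLp h' 2 (volume.restrict (Set.Icc a b)))
    (hftc : ∀ u ∈ Set.Icc a b, ∀ v ∈ Set.Icc a b, u ≤ v → ∫ s in u..v, h' s = h v - h u)
    (hg : MemLp g 2 (volume.restrict (Set.Icc a b))) :
    IsStochIntegral P (fun t _ => h t) a b g (fun _ => ∫ s in Set.Icc a b, g s * h' s) := by
  refine ⟨hg, memLp_const _, fun φ hφ => ?_⟩
  have helem : ∀ k ω, (φ k).elemIntegral (fun t (_ : Ω) => h t) ω =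
      ∫ s in Set.Icc a b, (φ k).toFun s * h' s := fun k ω =>
    (φ k).elemIntegral_deterministic (hh'.integrable (by norm_num)) hftc ω
  have hlim := tendsto_integral_mul_of_tendsto_eLpNorm (fun k => (φ k).memLp_toFun) hg
    (fun _ : ℕ => hh') hh' hφ (by simp)
  have h0 := (hlim.sub_const (∫ s in Set.Icc a b, g s * h' s)).enorm
  simp only [helem]
  simp only [sub_self, enorm_zero] at h0
  -- The elementary integrals do not depend on `ω`, so their `L²(P)` error is an absolute value
  -- times a fixed power of the total mass.
  have h2 : Tendsto (fun k => ‖(∫ s in Set.Icc a b, (φ k).toFun s * h' s) -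
      ∫ s in Set.Icc a b, g s * h' s‖ₑ * P Set.univ ^ (1 / (2 : ℝ≥0∞).toReal)) atTop (𝓝 0) := by
    have := ENNReal.Tendsto.mul_const h0 (b := P Set.univ ^ (1 / (2 : ℝ≥0∞).toReal))
      (Or.inr (ENNReal.rpow_ne_top_of_nonneg (by positivity) (measure_ne_top _ _)))
    simpa using this
  simpa only [eLpNorm_const' _ (two_ne_zero (α := ℝ≥0∞)) ENNReal.ofNat_ne_top] using h2

namespace IsStochIntegral

variable {X X' : ℝ → Ω → ℝ} {g g' : ℝ → ℝ} {I I' : Ω → ℝ}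

theorem add (h : IsStochIntegral P X a b g I) (h' : IsStochIntegral P X' a b g I')
    (hX : ∀ t ∈ Set.Icc a b, MemLp (X t) 2 P) (hX' : ∀ t ∈ Set.Icc a b, MemLp (X' t) 2 P) :
    IsStochIntegral P (fun t ω => X t ω + X' t ω) a b g (fun ω => I ω + I' ω) := by
  refine ⟨h.1, h.2.1.add h'.2.1, fun φ hφ => ?_⟩
  have h0 := (h.2.2 φ hφ).add (h'.2.2 φ hφ)
  rw [add_zero] at h0
  refine tendsto_of_tendsto_of_tendsto_of_le_of_le tendsto_const_nhds h0 (fun _ => zero_le)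
    fun k => ?_
  have he : (fun ω => (φ k).elemIntegral (fun t ω => X t ω + X' t ω) ω - (I ω + I' ω)) =
      (fun ω => (φ k).elemIntegral X ω - I ω) + fun ω => (φ k).elemIntegral X' ω - I' ω := by
    ext ω
    simp only [StepFunction.elemIntegral_add, Pi.add_apply]
    ring
  simp only [he]
  exact eLpNorm_add_le (((φ k).memLp_elemIntegral hX).sub h.2.1).aestronglyMeasurable
    (((φ k).memLp_elemIntegral hX').sub h'.2.1).aestronglyMeasurable (by norm_num)

/-- Continuity of `g` supplies at least one approximating sequence, without which the limit
condition would be vacuous; uniqueness of `L²` limits does the rest. -/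
theorem ae_eq (hab : a < b) (hX : ∀ t ∈ Set.Icc a b, MemLp (X t) 2 P)
    (hg : ContinuousOn g (Set.Icc a b)) (h : IsStochIntegral P X a b g I)
    (h' : IsStochIntegral P X a b g I') : I =ᵐ[P] I' := by
  obtain ⟨φ, hφ⟩ := StepFunction.exists_tendsto_eLpNorm_sub hab hg
  exact ae_eq_of_tendsto_eLpNorm_sub (fun k => (φ k).memLp_elemIntegral hX) h.2.1 h'.2.1
    (h.2.2 φ hφ) (h'.2.2 φ hφ)

theorem integral_eq_zero [IsFiniteMeasure P] (hab : a < b)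
    (hX : ∀ t ∈ Set.Icc a b, MemLp (X t) 2 P) (h0 : ∀ t ∈ Set.Icc a b, ∫ ω, X t ω ∂P = 0)
    (hg : ContinuousOn g (Set.Icc a b)) (h : IsStochIntegral P X a b g I) :
    ∫ ω, I ω ∂P = 0 := by
  obtain ⟨φ, hφ⟩ := StepFunction.exists_tendsto_eLpNorm_sub hab hg
  -- The expectation is the `L²` pairing with the constant 1, hence continuous.
  have := tendsto_integral_mul_of_tendsto_eLpNorm (fun k => (φ k).memLp_elemIntegral hX) h.2.1
    (fun _ : ℕ => memLp_const (1 : ℝ)) (memLp_const 1) (h.2.2 φ hφ) (by simp)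
  simp only [mul_one, StepFunction.integral_elemIntegral_eq_zero _ hX h0] at this
  exact (tendsto_nhds_unique this tendsto_const_nhds)

/-- Itô isometry for the error of approximating a Wiener integral by elementary integrals. -/
theorem integral_sub_elemIntegral_mul (hab : a < b) {κ : ℝ}
    (hX : ∀ t ∈ Set.Icc a b, MemLp (X t) 2 P) (hX' : ∀ t ∈ Set.Icc a b, MemLp (X' t) 2 P)
    (hcov : ∀ s ∈ Set.Icc a b, ∀ t ∈ Set.Icc a b, ∫ ω, X s ω * X' t ω ∂P = κ * min s t)
    (hg : ContinuousOn g (Set.Icc a b)) (hg' : ContinuousOn g' (Set.Icc a b))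
    (h : IsStochIntegral P X a b g I) (h' : IsStochIntegral P X' a b g' I')
    (φ ψ : StepFunction a b) :
    ∫ ω, (I ω - φ.elemIntegral X ω) * (I' ω - ψ.elemIntegral X' ω) ∂P =
      κ * ∫ s in Set.Icc a b, (g s - φ.toFun s) * (g' s - ψ.toFun s) := by
  obtain ⟨φ', hφ'⟩ := StepFunction.exists_tendsto_eLpNorm_sub hab hg
  obtain ⟨ψ', hψ'⟩ := StepFunction.exists_tendsto_eLpNorm_sub hab hg'
  -- `h1` and `h2` pass to the limit on the two sides of the isometry for `φ' k - φ` and `ψ' k - ψ`.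
  have h1 := tendsto_integral_mul_of_tendsto_eLpNorm
    (fun k => ((φ' k).memLp_elemIntegral hX).sub (φ.memLp_elemIntegral hX))
    (h.2.1.sub (φ.memLp_elemIntegral hX))
    (fun k => ((ψ' k).memLp_elemIntegral hX').sub (ψ.memLp_elemIntegral hX'))
    (h'.2.1.sub (ψ.memLp_elemIntegral hX'))
    (by simpa using h.2.2 φ' hφ') (by simpa using h'.2.2 ψ' hψ')
  have h2 := tendsto_integral_mul_of_tendsto_eLpNorm
    (fun k => (φ' k).memLp_toFun.sub φ.memLp_toFun) (h.1.sub φ.memLp_toFun)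
    (fun k => (ψ' k).memLp_toFun.sub ψ.memLp_toFun) (h'.1.sub ψ.memLp_toFun)
    (by simpa using hφ') (by simpa using hψ')
  simp only [Pi.sub_apply] at h1 h2
  simp only [StepFunction.integral_elemIntegral_sub_mul_sub _ _ _ _ hX hX' hcov] at h1
  exact tendsto_nhds_unique h1 (h2.const_mul κ)

end IsStochIntegral

theorem isStochIntegral_stochIntegral {X : ℝ → Ω → ℝ} {g : ℝ → ℝ} {I : Ω → ℝ}
    (h : IsStochIntegral P X a b g I) : IsStochIntegral P X a b g (stochIntegral P X a b g) := by
  have hex : ∃ I, IsStochIntegral P X a b g I := ⟨I, h⟩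
  rw [stochIntegral, dif_pos hex]
  exact hex.choose_spec

end StochIntegral

/-! ### Moments of the Brownian noise -/

section Noise

variable {Ω : Type*} {mΩ : MeasurableSpace Ω} {P : Measure Ω} {ε : Fin 2 → ℝ≥0 → Ω → ℝ}

theorem memLp_two_brownian (hε : ∀ c, IsBrownianReal (ε c) P) (c : Fin 2) (t : ℝ≥0) :
    MemLp (ε c t) 2 P :=
  ((hε c).hasLaw_eval t).hasGaussianLaw.memLp_two

theorem integral_brownian_mul [IsProbabilityMeasure P] (hε : ∀ c, IsBrownianReal (ε c) P)
    (hindep : IndepFun (fun ω u => ε 0 u ω) (fun ω u => ε 1 u ω) P) (c d : Fin 2) (s t : ℝ≥0) :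
    ∫ ω, ε c s ω * ε d t ω ∂P = if c = d then ((min s t : ℝ≥0) : ℝ) else 0 := by
  have key : ∀ u v, ∫ ω, ε 0 u ω * ε 1 v ω ∂P = 0 := by
    intro u v
    have h := hindep.comp (measurable_pi_apply u) (measurable_pi_apply v)
    have h2 := h.integral_fun_mul_eq_mul_integral
      (memLp_two_brownian hε 0 u).aestronglyMeasurable
      (memLp_two_brownian hε 1 v).aestronglyMeasurable
    refine h2.trans ?_
    simp only [Function.comp_apply]
    rw [(hε 0).integral_eval, zero_mul]
  split_ifs with hcd
  · subst hcd
    have h := covariance_eq_sub (memLp_two_brownian hε c s) (memLp_two_brownian hε c t)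
    rw [(hε c).covariance_eval, (hε c).integral_eval, zero_mul, sub_zero] at h
    simpa using h.symm
  · fin_cases c <;> fin_cases d
    · exact absurd rfl hcd
    · exact key s t
    · exact (integral_congr_ae (.of_forall fun ω => mul_comm _ _)).trans (key t s)
    · exact absurd rfl hcd

theorem memLp_two_mulVec_brownian (hε : ∀ c, IsBrownianReal (ε c) P)
    (A : Matrix (Fin 2) (Fin 2) ℝ) (c : Fin 2) (t : ℝ) :
    MemLp (fun ω => (A *ᵥ fun d => ε d t.toNNReal ω) c) 2 P := by
  simp only [Matrix.mulVec, dotProduct]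
  exact memLp_finsetSum _ fun d _ => (memLp_two_brownian hε d _).const_mul _

theorem integral_mulVec_brownian [IsProbabilityMeasure P] (hε : ∀ c, IsBrownianReal (ε c) P)
    (A : Matrix (Fin 2) (Fin 2) ℝ) (c : Fin 2) (t : ℝ) :
    ∫ ω, (A *ᵥ fun d => ε d t.toNNReal ω) c ∂P = 0 := by
  simp only [Matrix.mulVec, dotProduct]
  rw [integral_finsetSum _ fun d _ => ((hε d).integrable_eval _).const_mul _]
  simp [integral_const_mul, (hε _).integral_eval]

/-- Independence kills the terms with distinct components. For `A` the square root of `S` the kernel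
is `S c c' * min s t`, as the isometry requires; nonnegative times make `toNNReal` harmless. -/
theorem integral_mulVec_brownian_mul [IsProbabilityMeasure P]
    (hε : ∀ c, IsBrownianReal (ε c) P)
    (hindep : IndepFun (fun ω u => ε 0 u ω) (fun ω u => ε 1 u ω) P)
    (A : Matrix (Fin 2) (Fin 2) ℝ) (c c' : Fin 2) {s t : ℝ} (hs : 0 ≤ s) (ht : 0 ≤ t) :
    ∫ ω, (A *ᵥ fun d => ε d s.toNNReal ω) c * (A *ᵥ fun d => ε d t.toNNReal ω) c' ∂P =
      (A * Aᵀ) c c' * min s t := by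
  have hint : ∀ d d', Integrable (fun ω => A c d * A c' d' *
      (ε d s.toNNReal ω * ε d' t.toNNReal ω)) P := fun d d' =>
    ((memLp_two_brownian hε d _).integrable_mul (memLp_two_brownian hε d' _)).const_mul _
  simp only [Matrix.mulVec, dotProduct, Finset.sum_mul_sum, mul_mul_mul_comm]
  rw [integral_finsetSum _ fun d _ => integrable_finsetSum _ fun d' _ => hint d d']
  simp only [integral_finsetSum _ fun d' _ => hint _ d', integral_const_mul,
    integral_brownian_mul hε hindep, mul_ite, mul_zero, Finset.sum_ite_eq, Finset.mem_univ, if_true,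
    Matrix.mul_apply, Matrix.transpose_apply, Finset.sum_mul]
  simp [NNReal.coe_min, hs, ht]

end Noise

/-! ### The covariance matrix and its square root -/

section CovMatrix

theorem covMatrix_posDef {σ₁ σ₂ ρ : ℝ} (hσ₁ : 0 < σ₁) (hσ₂ : 0 < σ₂)
    (hρ : ρ ∈ Set.Ioo (-1 : ℝ) 1) : (covMatrix σ₁ σ₂ ρ).PosDef := by
  refine Matrix.PosDef.of_dotProduct_mulVec_pos ?_ fun x hx => ?_
  · ext i j
    fin_cases i <;> fin_cases j <;> simp [covMatrix]
  · have hρ2 : 0 < 1 - ρ ^ 2 := by nlinarith [hρ.1, hρ.2]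
    -- Completing the square in `x 0`: the second square is positive unless `x 1 = 0`, and then the
    -- first one is.
    have hq : star x ⬝ᵥ covMatrix σ₁ σ₂ ρ *ᵥ x =
        (σ₁ * x 0 + ρ * (σ₂ * x 1)) ^ 2 + (1 - ρ ^ 2) * (σ₂ * x 1) ^ 2 := by
      simp [covMatrix, dotProduct, Matrix.mulVec, Fin.sum_univ_two]
      ring
    rw [hq]
    by_cases h1 : x 1 = 0
    · have h0 : x 0 ≠ 0 := fun h0 => hx (by ext i; fin_cases i <;> simp [h0, h1])
      simp only [h1, mul_zero, add_zero, zero_pow two_ne_zero]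
      positivity
    · positivity

theorem sqrt_mul_transpose_sqrt {n : Type*} [Fintype n] [DecidableEq n] {S : Matrix n n ℝ}
    (hS : S.PosSemidef) : CFC.sqrt S * (CFC.sqrt S)ᵀ = S := by
  have h : (CFC.sqrt S).PosSemidef := Matrix.nonneg_iff_posSemidef.1 (CFC.sqrt_nonneg S)
  have ht : (CFC.sqrt S)ᵀ = CFC.sqrt S := by
    rw [← Matrix.conjTranspose_eq_transpose_of_trivial]
    exact h.isHermitian.eq
  rw [ht, CFC.sqrt_mul_sqrt_self S hS.nonneg]

end CovMatrix

/-! ### Second moments of sums, shifts and linear images -/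

section Moments

variable {Ω : Type*} {mΩ : MeasurableSpace Ω} {P : Measure Ω}

theorem integral_sum_mul_sum {ι κ : Type*} [Fintype ι] [Fintype κ] {f : ι → Ω → ℝ}
    {g : κ → Ω → ℝ} (hf : ∀ i, MemLp (f i) 2 P) (hg : ∀ j, MemLp (g j) 2 P) :
    ∫ ω, (∑ i, f i ω) * (∑ j, g j ω) ∂P = ∑ i, ∑ j, ∫ ω, f i ω * g j ω ∂P := by
  have hint : ∀ i j, Integrable (fun ω => f i ω * g j ω) P := fun i j =>
    (hf i).integrable_mul (hg j)
  simp only [Finset.sum_mul_sum]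
  rw [integral_finsetSum _ fun i _ => integrable_finsetSum _ fun j _ => hint i j]
  exact Finset.sum_congr rfl fun i _ => integral_finsetSum _ fun j _ => hint i j

theorem integral_const_add_mul_const_add [IsProbabilityMeasure P] {f g : Ω → ℝ}
    (hf : MemLp f 2 P) (hg : MemLp g 2 P) (hf0 : ∫ ω, f ω ∂P = 0) (hg0 : ∫ ω, g ω ∂P = 0)
    (x y : ℝ) : ∫ ω, (x + f ω) * (y + g ω) ∂P = x * y + ∫ ω, f ω * g ω ∂P := by
  have hfi := hf.integrable (by norm_num : (1 : ℝ≥0∞) ≤ 2)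
  have hgi := hg.integrable (by norm_num : (1 : ℝ≥0∞) ≤ 2)
  have hfg : Integrable (fun ω => f ω * g ω) P := hf.integrable_mul hg
  have he : ∀ ω, (x + f ω) * (y + g ω) = x * y + x * g ω + y * f ω + f ω * g ω := by
    intro ω; ring
  have h1 : Integrable (fun ω => x * y + x * g ω) P := (integrable_const _).add (hgi.const_mul x)
  have h2 : Integrable (fun ω => x * y + x * g ω + y * f ω) P := h1.add (hfi.const_mul y)
  simp only [he]
  rw [integral_add h2 hfg, integral_add h1 (hfi.const_mul y),
    integral_add (integrable_const _) (hgi.const_mul x), integral_const_mul x g,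
    integral_const_mul y f, hf0, hg0]
  simp

theorem integral_mulVec_mul_mulVec {n : Type*} [Fintype n] (A : Matrix n n ℝ) {V : Ω → n → ℝ}
    (hV : ∀ r, MemLp (fun ω => V ω r) 2 P) :
    (Matrix.of fun r q => ∫ ω, (A *ᵥ V ω) r * (A *ᵥ V ω) q ∂P) =
      A * (Matrix.of fun r q => ∫ ω, V ω r * V ω q ∂P) * Aᵀ := by
  ext r q
  simp only [Matrix.of_apply, Matrix.mulVec, dotProduct]
  rw [integral_sum_mul_sum (fun i => (hV i).const_mul _) (fun i => (hV i).const_mul _)]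
  simp only [Matrix.mul_apply, Matrix.of_apply, Matrix.transpose_apply, Finset.sum_mul]
  rw [Finset.sum_comm]
  refine Finset.sum_congr rfl fun j _ => Finset.sum_congr rfl fun i _ => ?_
  simp only [mul_mul_mul_comm (A r i), integral_const_mul]
  ring

end Moments

/-! ### Regression functions and symmetry of the information matrix -/

section Regression

variable {a b : ℝ}

theorem memLp_two_of_continuousOn_Icc {f : ℝ → ℝ} (hf : ContinuousOn f (Set.Icc a b)) :
    MemLp f 2 (volume.restrict (Set.Icc a b)) := by
  obtain ⟨C, hC⟩ := isCompact_Icc.exists_bound_of_continuousOn hf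
  exact MemLp.of_bound (hf.aestronglyMeasurable measurableSet_Icc) C
    ((ae_restrict_iff' measurableSet_Icc).2 (.of_forall hC))

/-- The fundamental theorem needs a two-sided derivative only in the open interval, where
`derivWithin` is one. -/
theorem integral_derivWithin_Icc (hab : a < b) {f : ℝ → ℝ} (hf : ContDiffOn ℝ 1 f (Set.Icc a b))
    {u v : ℝ} (hu : u ∈ Set.Icc a b) (hv : v ∈ Set.Icc a b) (huv : u ≤ v) :
    ∫ s in u..v, derivWithin f (Set.Icc a b) s = f v - f u := by
  have hsub : Set.Icc u v ⊆ Set.Icc a b := Set.Icc_subset_Icc hu.1 hv.2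
  have hc := hf.continuousOn_derivWithin (uniqueDiffOn_Icc hab) le_rfl
  refine intervalIntegral.integral_eq_sub_of_hasDerivAt_of_le huv (hf.continuousOn.mono hsub)
    (fun x hx => ?_) ((hc.mono hsub).intervalIntegrable_of_Icc huv)
  have hx' : x ∈ Set.Ioo a b := Set.Ioo_subset_Ioo hu.1 hv.2 hx
  have := (hf.differentiableOn one_ne_zero x (Set.Ioo_subset_Icc_self hx')).hasDerivWithinAt
  exact this.hasDerivAt (Icc_mem_nhds hx'.1 hx'.2)

variable {p : ℕ} {F : ℝ → Matrix (Fin p) (Fin 2) ℝ}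

theorem continuousOn_matDeriv (hab : a < b)
    (hF : ∀ r c, ContDiffOn ℝ 1 (fun s => F s r c) (Set.Icc a b)) (r : Fin p) (c : Fin 2) :
    ContinuousOn (fun s => matDeriv a b F s r c) (Set.Icc a b) :=
  (hF r c).continuousOn_derivWithin (uniqueDiffOn_Icc hab) le_rfl

theorem continuousOn_matDeriv_mul (hab : a < b)
    (hF : ∀ r c, ContDiffOn ℝ 1 (fun s => F s r c) (Set.Icc a b))
    (B : Matrix (Fin 2) (Fin 2) ℝ) (r : Fin p) (c : Fin 2) :
    ContinuousOn (fun s => (matDeriv a b F s * B) r c) (Set.Icc a b) := by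
  simp only [Matrix.mul_apply]
  exact continuousOn_finsetSum _ fun d _ => (continuousOn_matDeriv hab hF r d).mul_const _

theorem continuousOn_transpose_matDeriv_mulVec (hab : a < b)
    (hF : ∀ r c, ContDiffOn ℝ 1 (fun s => F s r c) (Set.Icc a b)) (θ : Fin p → ℝ) (c : Fin 2) :
    ContinuousOn (fun s => ((matDeriv a b F s)ᵀ *ᵥ θ) c) (Set.Icc a b) := by
  simp only [Matrix.mulVec, dotProduct, Matrix.transpose_apply]
  exact continuousOn_finsetSum _ fun d _ => (continuousOn_matDeriv hab hF d c).mul_const _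

theorem integral_transpose_matDeriv_mulVec (hab : a < b)
    (hF : ∀ r c, ContDiffOn ℝ 1 (fun s => F s r c) (Set.Icc a b)) (θ : Fin p → ℝ) (c : Fin 2)
    {u v : ℝ} (hu : u ∈ Set.Icc a b) (hv : v ∈ Set.Icc a b) (huv : u ≤ v) :
    ∫ s in u..v, ((matDeriv a b F s)ᵀ *ᵥ θ) c = ((F v)ᵀ *ᵥ θ) c - ((F u)ᵀ *ᵥ θ) c := by
  simp only [Matrix.mulVec, dotProduct, Matrix.transpose_apply, ← Finset.sum_sub_distrib,
    ← sub_mul]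
  rw [intervalIntegral.integral_finsetSum]
  · refine Finset.sum_congr rfl fun r _ => ?_
    rw [intervalIntegral.integral_mul_const]
    congr 1
    exact integral_derivWithin_Icc hab (hF r c) hu hv huv
  · intro r _
    exact (((continuousOn_matDeriv hab hF r c).mono
      (Set.Icc_subset_Icc hu.1 hv.2)).intervalIntegrable_of_Icc huv).mul_const _

theorem transpose_matIntegral {m n : Type*} (G : ℝ → Matrix m n ℝ) :
    (matIntegral a b G)ᵀ = matIntegral a b fun s => (G s)ᵀ := rfl

theorem infoMatrix_transpose {S : Matrix (Fin 2) (Fin 2) ℝ} (hS : Sᵀ = S) :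
    (infoMatrix a b F S)ᵀ = infoMatrix a b F S := by
  have h : ∀ B : Matrix (Fin p) (Fin 2) ℝ, (B * S⁻¹ * Bᵀ)ᵀ = B * S⁻¹ * Bᵀ := by
    intro B
    simp [Matrix.transpose_mul, Matrix.transpose_nonsing_inv, hS, Matrix.mul_assoc]
  simp only [infoMatrix, Matrix.transpose_add, Matrix.transpose_smul, transpose_matIntegral, h]

end Regression

/-! ### The observed process and the error of the discretised integral -/

section Observation

variable {p m : ℕ} {a b : ℝ} {Ω : Type*} {mΩ : MeasurableSpace Ω} {P : Measure Ω}
  {F : ℝ → Matrix (Fin p) (Fin 2) ℝ} {S : Matrix (Fin 2) (Fin 2) ℝ} {ε : Fin 2 → ℝ≥0 → Ω → ℝ}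

theorem memLp_two_observation [IsProbabilityMeasure P] (hε : ∀ c, IsBrownianReal (ε c) P)
    (θ : Fin p → ℝ) (c : Fin 2) (t : ℝ) : MemLp (fun ω => observation F S ε θ t ω c) 2 P := by
  simp only [observation, Pi.add_apply]
  exact (memLp_const (((F t)ᵀ *ᵥ θ) c)).add (memLp_two_mulVec_brownian hε (CFC.sqrt S) c t)

/-- The stochastic integral of a continuous function with respect to the observed process is the
sum of its drift part and a Wiener integral with respect to the noise. -/
theorem exists_isStochIntegral_noise_and_observation [IsProbabilityMeasure P] (ha : 0 ≤ a)
    (hab : a < b) (hS : S.PosSemidef)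
    (hF : ∀ r c, ContDiffOn ℝ 1 (fun s => F s r c) (Set.Icc a b))
    (hε : ∀ c, IsBrownianReal (ε c) P)
    (hindep : IndepFun (fun ω u => ε 0 u ω) (fun ω u => ε 1 u ω) P)
    (θ : Fin p → ℝ) (c : Fin 2) {g : ℝ → ℝ} (hg : ContinuousOn g (Set.Icc a b)) :
    ∃ I, IsStochIntegral P
        (fun t ω => (CFC.sqrt S *ᵥ fun d => ε d t.toNNReal ω) c) a b g I ∧
      IsStochIntegral P (fun t ω => observation F S ε θ t ω c) a b g
        (fun ω => (∫ s in Set.Icc a b, g s * ((matDeriv a b F s)ᵀ *ᵥ θ) c) + I ω) := by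
  have hgm := memLp_two_of_continuousOn_Icc hg
  obtain ⟨I, hI⟩ := exists_isStochIntegral (κ := S c c) hab
    (fun t _ => memLp_two_mulVec_brownian hε (CFC.sqrt S) c t)
    (fun s hs t ht => by
      rw [integral_mulVec_brownian_mul hε hindep _ c c (ha.trans hs.1) (ha.trans ht.1),
        sqrt_mul_transpose_sqrt hS]) hg hgm
  have hdet := isStochIntegral_deterministic (P := P)
    (memLp_two_of_continuousOn_Icc (continuousOn_transpose_matDeriv_mulVec hab hF θ c))
    (fun u hu v hv huv => integral_transpose_matDeriv_mulVec hab hF θ c hu hv huv) hgm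
  exact ⟨I, hI, hdet.add hI (fun _ _ => memLp_const _)
    (fun t _ => memLp_two_mulVec_brownian hε (CFC.sqrt S) c t)⟩

/-- The step function on the design points `t` with the weights `(Φ i * S⁻¹) r c`. -/
noncomputable def weightStep (S : Matrix (Fin 2) (Fin 2) ℝ) (t : Fin (m + 1) → ℝ) (ht : StrictMono t)
    (ht_first : t 0 = a) (ht_last : t (Fin.last m) = b) (Φ : Fin m → Matrix (Fin p) (Fin 2) ℝ)
    (r : Fin p) (c : Fin 2) : StepFunction a b where
  size := m
  node := t
  mono := ht.monotone
  node_first := ht_first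
  node_last := ht_last
  coef i := (Φ i * S⁻¹) r c

/-- The statistic `∫ Ḟ S⁻¹ dY - ∑ i, Φ i S⁻¹ (Y(t (i + 1)) - Y(t i))`. -/
noncomputable def integralError (P : Measure Ω) (F : ℝ → Matrix (Fin p) (Fin 2) ℝ)
    (S : Matrix (Fin 2) (Fin 2) ℝ) (φ : Fin p → Fin 2 → StepFunction a b)
    (Y : ℝ → Ω → Fin 2 → ℝ) (ω : Ω) (r : Fin p) : ℝ :=
  ∑ c, (stochIntegral P (fun t ω' => Y t ω' c) a b (fun s => (matDeriv a b F s * S⁻¹) r c) ω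
    - (φ r c).elemIntegral (fun t ω' => Y t ω' c) ω)

/-- The terms at time `a` cancel, and the weighted increments of `Y` are elementary integrals of
step functions on the design points. -/
theorem blue_sub_discreteEstimator (t : Fin (m + 1) → ℝ) (ht : StrictMono t) (ht_first : t 0 = a)
    (ht_last : t (Fin.last m) = b) (Φ : Fin m → Matrix (Fin p) (Fin 2) ℝ)
    (Y : ℝ → Ω → Fin 2 → ℝ) (ω : Ω) :
    blue P a b F S Y ω - discreteEstimator a b F S t Φ Y ω = (infoMatrix a b F S)⁻¹ *ᵥ
      integralError P F S (weightStep S t ht ht_first ht_last Φ) Y ω := by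
  rw [blue, discreteEstimator, ← Matrix.mulVec_sub, add_sub_add_right_eq_sub]
  congr 1
  ext r
  simp only [integralError, Pi.sub_apply, Finset.sum_sub_distrib, Finset.sum_apply]
  congr 1
  simp only [StepFunction.elemIntegral, weightStep, Matrix.mulVec, dotProduct, Pi.sub_apply]
  exact Finset.sum_comm

theorem memLp_two_integralError [IsProbabilityMeasure P] (hε : ∀ c, IsBrownianReal (ε c) P)
    (θ : Fin p → ℝ) (φ : Fin p → Fin 2 → StepFunction a b)
    (hI : ∀ r c, MemLp (stochIntegral P (fun t ω' => observation F S ε θ t ω' c) a b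
      (fun s => (matDeriv a b F s * S⁻¹) r c)) 2 P) (r : Fin p) :
    MemLp (fun ω => integralError P F S φ (observation F S ε θ) ω r) 2 P :=
  memLp_finsetSum _ fun c _ =>
    (hI r c).sub ((φ r c).memLp_elemIntegral fun t _ => memLp_two_observation hε θ c t)

/-- The second moments of the error of a discretised stochastic integral. -/
theorem integral_integralError_mul [IsProbabilityMeasure P] (ha : 0 ≤ a)
    (hab : a < b) (hS : S.PosSemidef)
    (hF : ∀ r c, ContDiffOn ℝ 1 (fun s => F s r c) (Set.Icc a b))
    (hε : ∀ c, IsBrownianReal (ε c) P)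
    (hindep : IndepFun (fun ω u => ε 0 u ω) (fun ω u => ε 1 u ω) P)
    (θ : Fin p → ℝ) (φ : Fin p → Fin 2 → StepFunction a b) (r q : Fin p) :
    ∫ ω, integralError P F S φ (observation F S ε θ) ω r *
        integralError P F S φ (observation F S ε θ) ω q ∂P =
      (∑ c, ∫ s in Set.Icc a b, ((matDeriv a b F s * S⁻¹) r c - (φ r c).toFun s) *
          ((matDeriv a b F s)ᵀ *ᵥ θ) c) *
        (∑ c, ∫ s in Set.Icc a b, ((matDeriv a b F s * S⁻¹) q c - (φ q c).toFun s) *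
          ((matDeriv a b F s)ᵀ *ᵥ θ) c) +
      ∑ c, ∑ c', S c c' * ∫ s in Set.Icc a b,
        ((matDeriv a b F s * S⁻¹) r c - (φ r c).toFun s) *
          ((matDeriv a b F s * S⁻¹) q c' - (φ q c').toFun s) := by
  have hg := continuousOn_matDeriv_mul hab hF S⁻¹
  choose I hI hIY using fun r c =>
    exists_isStochIntegral_noise_and_observation ha hab hS hF hε hindep θ c (hg r c)
  have hZ := fun c t => memLp_two_mulVec_brownian hε (CFC.sqrt S) c t
  have hZm : ∀ c, ∀ t ∈ Set.Icc a b,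
      MemLp (fun ω => (CFC.sqrt S *ᵥ fun d => ε d t.toNNReal ω) c) 2 P := fun c t _ => hZ c t
  have hh' := fun c => continuousOn_transpose_matDeriv_mulVec hab hF θ c
  have hhm := fun c => memLp_two_of_continuousOn_Icc (hh' c)
  set Z : Fin 2 → ℝ → Ω → ℝ := fun c t ω => (CFC.sqrt S *ᵥ fun d => ε d t.toNNReal ω) c
  -- The centred noise part of the error, to which the isometry applies.
  let J : Fin p → Fin 2 → Ω → ℝ := fun r c ω => I r c ω - (φ r c).elemIntegral (Z c) ω
  have hJ : ∀ r c, MemLp (J r c) 2 P := fun r c =>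
    (hI r c).2.1.sub ((φ r c).memLp_elemIntegral (hZm c))
  have hJ0 : ∀ r c, ∫ ω, J r c ω ∂P = 0 := by
    intro r c
    have hZ0 : ∀ t ∈ Set.Icc a b, ∫ ω, Z c t ω ∂P = 0 := fun t _ =>
      integral_mulVec_brownian hε (CFC.sqrt S) c t
    rw [integral_sub ((hI r c).2.1.integrable (by norm_num))
      (((φ r c).memLp_elemIntegral (hZm c)).integrable (by norm_num)),
      (hI r c).integral_eq_zero hab (hZm c) hZ0 (hg r c),
      (φ r c).integral_elemIntegral_eq_zero (hZm c) hZ0, sub_zero]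
  have hJJ : ∀ r q c c', ∫ ω, J r c ω * J q c' ω ∂P = S c c' * ∫ s in Set.Icc a b,
        ((matDeriv a b F s * S⁻¹) r c - (φ r c).toFun s) *
          ((matDeriv a b F s * S⁻¹) q c' - (φ q c').toFun s) := by
    intro r q c c'
    refine (hI r c).integral_sub_elemIntegral_mul hab (hZm c) (hZm c') ?_ (hg r c) (hg q c')
      (hI q c') (φ r c) (φ q c')
    intro s hs t ht
    have h := integral_mulVec_brownian_mul hε hindep (CFC.sqrt S) c c' (ha.trans hs.1)
      (ha.trans ht.1)
    rwa [sqrt_mul_transpose_sqrt hS] at h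
  have hV : ∀ r, ∀ᵐ ω ∂P, integralError P F S φ (observation F S ε θ) ω r =
      (∑ c, ∫ s in Set.Icc a b, ((matDeriv a b F s * S⁻¹) r c - (φ r c).toFun s) *
          ((matDeriv a b F s)ᵀ *ᵥ θ) c) + ∑ c, J r c ω := by
    intro r
    -- `stochIntegral` is an arbitrary version, so it agrees with drift plus Wiener integral only
    -- almost surely.
    have hae : ∀ᵐ ω ∂P, ∀ c, stochIntegral P (fun t ω' => observation F S ε θ t ω' c) a b
        (fun s => (matDeriv a b F s * S⁻¹) r c) ω =
        (∫ s in Set.Icc a b, (matDeriv a b F s * S⁻¹) r c * ((matDeriv a b F s)ᵀ *ᵥ θ) c)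
          + I r c ω :=
      ae_all_iff.2 fun c => (isStochIntegral_stochIntegral (hIY r c)).ae_eq hab
        (fun t _ => memLp_two_observation hε θ c t) (hg r c) (hIY r c)
    filter_upwards [hae] with ω hω
    rw [integralError, ← Finset.sum_add_distrib]
    refine Finset.sum_congr rfl fun c _ => ?_
    have h1 : (φ r c).elemIntegral (fun t ω' => observation F S ε θ t ω' c) ω =
        (∫ s in Set.Icc a b, (φ r c).toFun s * ((matDeriv a b F s)ᵀ *ᵥ θ) c)
          + (φ r c).elemIntegral (Z c) ω := by
      rw [← (φ r c).elemIntegral_deterministic ((hhm c).integrable (by norm_num))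
        (fun u hu v hv huv => integral_transpose_matDeriv_mulVec hab hF θ c hu hv huv) ω,
        ← StepFunction.elemIntegral_add]
      rfl
    have h2 : ∫ s in Set.Icc a b, ((matDeriv a b F s * S⁻¹) r c - (φ r c).toFun s) *
          ((matDeriv a b F s)ᵀ *ᵥ θ) c =
        (∫ s in Set.Icc a b, (matDeriv a b F s * S⁻¹) r c * ((matDeriv a b F s)ᵀ *ᵥ θ) c) -
        ∫ s in Set.Icc a b, (φ r c).toFun s * ((matDeriv a b F s)ᵀ *ᵥ θ) c := by
      simp only [sub_mul]
      exact integral_sub ((memLp_two_of_continuousOn_Icc (hg r c)).integrable_mul (hhm c))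
        ((φ r c).memLp_toFun.integrable_mul (hhm c))
    rw [hω c, h1, h2]
    simp only [J]
    ring
  have hsum : ∀ r, MemLp (fun ω => ∑ c, J r c ω) 2 P := fun r =>
    memLp_finsetSum _ fun c _ => hJ r c
  have hsum0 : ∀ r, ∫ ω, ∑ c, J r c ω ∂P = 0 := by
    intro r
    rw [integral_finsetSum _ fun c _ => (hJ r c).integrable (by norm_num)]
    exact Finset.sum_eq_zero fun c _ => hJ0 r c
  have hcongr := integral_congr_ae (μ := P) (f := fun ω =>
    integralError P F S φ (observation F S ε θ) ω r *
      integralError P F S φ (observation F S ε θ) ω q) (EventuallyEq.mul (hV r) (hV q))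
  refine hcongr.trans ((integral_const_add_mul_const_add (hsum r) (hsum q) (hsum0 r) (hsum0 q)
    _ _).trans ?_)
  rw [integral_sum_mul_sum (hJ r) (hJ q)]
  simp only [hJJ]

/-- Glues integrands that change from cell to cell into one function on `[a, b]`; agreement on
half-open cells suffices, as they cover all but the null point `a`. -/
theorem sum_matIntegral_eq_integral {n : Type*} (t : Fin (m + 1) → ℝ) (ht : StrictMono t)
    (ht_first : t 0 = a) (ht_last : t (Fin.last m) = b) (G : Fin m → ℝ → Matrix (Fin p) n ℝ)
    {f : ℝ → ℝ} {r : Fin p} {q : n} (hf : IntegrableOn f (Set.Icc a b))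
    (hfG : ∀ i, ∀ s ∈ Set.Ioc (t i.castSucc) (t i.succ), G i s r q = f s) :
    (∑ i, matIntegral (t i.castSucc) (t i.succ) (G i)) r q = ∫ s in Set.Icc a b, f s := by
  let φ : StepFunction a b := ⟨m, t, ht.monotone, ht_first, ht_last, 0⟩
  rw [φ.integral_Icc_eq_sum hf, Matrix.sum_apply]
  refine Finset.sum_congr rfl fun i _ => ?_
  have hle := φ.node_le i
  change ∫ s in t i.castSucc..t i.succ, G i s r q = ∫ s in t i.castSucc..t i.succ, f s
  rw [intervalIntegral.integral_of_le hle, intervalIntegral.integral_of_le hle]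
  exact setIntegral_congr_fun measurableSet_Ioc (hfG i)

/-! ### Drift and covariance as sums of matrix integrals -/

section Deterministic

variable (t : Fin (m + 1) → ℝ) (ht : StrictMono t) (ht_first : t 0 = a)
  (ht_last : t (Fin.last m) = b) (Φ : Fin m → Matrix (Fin p) (Fin 2) ℝ)

theorem sub_toFun_weightStep {i : Fin m} {s : ℝ} (hs : s ∈ Set.Ioc (t i.castSucc) (t i.succ))
    (B : Matrix (Fin p) (Fin 2) ℝ) (r : Fin p) (c : Fin 2) :
    (B * S⁻¹) r c - (weightStep S t ht ht_first ht_last Φ r c).toFun s =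
      ((B - Φ i) * S⁻¹) r c := by
  rw [(weightStep S t ht ht_first ht_last Φ r c).toFun_eq_coef (k := i) hs, Matrix.sub_mul]
  rfl

theorem sum_matIntegral_covariance (hab : a < b) (hS : S.PosDef)
    (hF : ∀ r c, ContDiffOn ℝ 1 (fun s => F s r c) (Set.Icc a b)) (r q : Fin p) :
    (∑ i, matIntegral (t i.castSucc) (t i.succ)
      (fun s => (matDeriv a b F s - Φ i) * S⁻¹ * (matDeriv a b F s - Φ i)ᵀ)) r q =
    ∑ c, ∑ c', S c c' * ∫ s in Set.Icc a b,
      ((matDeriv a b F s * S⁻¹) r c - (weightStep S t ht ht_first ht_last Φ r c).toFun s) *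
        ((matDeriv a b F s * S⁻¹) q c' -
          (weightStep S t ht ht_first ht_last Φ q c').toFun s) := by
  have hψ : ∀ r c, MemLp (fun s => (matDeriv a b F s * S⁻¹) r c -
      (weightStep S t ht ht_first ht_last Φ r c).toFun s) 2 (volume.restrict (Set.Icc a b)) :=
    fun r c => (memLp_two_of_continuousOn_Icc (continuousOn_matDeriv_mul hab hF S⁻¹ r c)).sub
      (weightStep S t ht ht_first ht_last Φ r c).memLp_toFun
  have hint : ∀ c c', Integrable (fun s => S c c' * (((matDeriv a b F s * S⁻¹) r c -
      (weightStep S t ht ht_first ht_last Φ r c).toFun s) * ((matDeriv a b F s * S⁻¹) q c' -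
      (weightStep S t ht ht_first ht_last Φ q c').toFun s))) (volume.restrict (Set.Icc a b)) :=
    fun c c' => ((hψ r c).integrable_mul (hψ q c')).const_mul _
  simp only [← integral_const_mul, ← integral_finsetSum _ fun c' _ => hint _ c']
  rw [← integral_finsetSum _ fun c _ => integrable_finsetSum _ fun c' _ => hint c c']
  refine sum_matIntegral_eq_integral t ht ht_first ht_last _
    (integrable_finsetSum _ fun c _ => integrable_finsetSum _ fun c' _ => hint c c') ?_
  intro i s hs
  simp only [sub_toFun_weightStep t ht ht_first ht_last Φ hs]
  set B := matDeriv a b F s - Φ i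
  have hSt : Sᵀ = S := by
    rw [← Matrix.conjTranspose_eq_transpose_of_trivial]
    exact hS.isHermitian.eq
  -- Inserting `S⁻¹ = S⁻¹ S S⁻¹` exhibits the noise covariance `S` between two copies of the
  -- integrand `B S⁻¹`.
  have hB : B * S⁻¹ * Bᵀ = B * S⁻¹ * S * (B * S⁻¹)ᵀ := by
    rw [Matrix.transpose_mul, Matrix.transpose_nonsing_inv, hSt, Matrix.mul_assoc (B * S⁻¹) S,
      ← Matrix.mul_assoc S, Matrix.mul_nonsing_inv _ ((Matrix.isUnit_iff_isUnit_det _).1 hS.isUnit),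
      Matrix.one_mul]
  rw [hB, Matrix.mul_apply]
  simp only [Matrix.mul_apply (M := B * S⁻¹) (N := S), Matrix.transpose_apply, Finset.sum_mul]
  rw [Finset.sum_comm]
  exact Finset.sum_congr rfl fun _ _ => Finset.sum_congr rfl fun _ _ => by ring

theorem sum_matIntegral_mulVec (hab : a < b)
    (hF : ∀ r c, ContDiffOn ℝ 1 (fun s => F s r c) (Set.Icc a b)) (θ : Fin p → ℝ) (r : Fin p) :
    ((∑ i, matIntegral (t i.castSucc) (t i.succ)
      (fun s => (matDeriv a b F s - Φ i) * S⁻¹ * (matDeriv a b F s)ᵀ)) *ᵥ θ) r =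
    ∑ c, ∫ s in Set.Icc a b,
      ((matDeriv a b F s * S⁻¹) r c - (weightStep S t ht ht_first ht_last Φ r c).toFun s) *
        ((matDeriv a b F s)ᵀ *ᵥ θ) c := by
  have hψ : ∀ r c, MemLp (fun s => (matDeriv a b F s * S⁻¹) r c -
      (weightStep S t ht ht_first ht_last Φ r c).toFun s) 2 (volume.restrict (Set.Icc a b)) :=
    fun r c => (memLp_two_of_continuousOn_Icc (continuousOn_matDeriv_mul hab hF S⁻¹ r c)).sub
      (weightStep S t ht ht_first ht_last Φ r c).memLp_toFun
  have hint : ∀ l c, Integrable (fun s => ((matDeriv a b F s * S⁻¹) r c -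
      (weightStep S t ht ht_first ht_last Φ r c).toFun s) * matDeriv a b F s l c)
      (volume.restrict (Set.Icc a b)) := fun l c =>
    (hψ r c).integrable_mul (memLp_two_of_continuousOn_Icc (continuousOn_matDeriv hab hF l c))
  have hentry : ∀ l, (∑ i, matIntegral (t i.castSucc) (t i.succ)
      (fun s => (matDeriv a b F s - Φ i) * S⁻¹ * (matDeriv a b F s)ᵀ)) r l =
      ∑ c, ∫ s in Set.Icc a b, ((matDeriv a b F s * S⁻¹) r c -
      (weightStep S t ht ht_first ht_last Φ r c).toFun s) * matDeriv a b F s l c := by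
    intro l
    rw [← integral_finsetSum _ fun c _ => hint l c]
    refine sum_matIntegral_eq_integral t ht ht_first ht_last _
      (integrable_finsetSum _ fun c _ => hint l c) ?_
    intro i s hs
    simp only [sub_toFun_weightStep t ht ht_first ht_last Φ hs]
    rw [Matrix.mul_apply]
    rfl
  rw [Matrix.mulVec, dotProduct]
  simp only [hentry, Finset.sum_mul]
  rw [Finset.sum_comm]
  refine Finset.sum_congr rfl fun c _ => ?_
  simp only [← integral_mul_const]
  rw [← integral_finsetSum _ fun l _ => (hint l c).mul_const _]
  simp only [Matrix.mulVec, dotProduct, Finset.mul_sum, Matrix.transpose_apply, mul_assoc]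

end Deterministic

end Observation

/-! ### The mean squared error formula -/

theorem mainTheorem8 {Ω : Type*} [MeasurableSpace Ω] (P : Measure Ω) [IsProbabilityMeasure P]
    (p m : ℕ) (a b : ℝ) (ha : 0 < a) (hab : a < b)
    (σ₁ σ₂ ρ : ℝ) (hσ₁ : 0 < σ₁) (hσ₂ : 0 < σ₂) (hρ : ρ ∈ Set.Ioo (-1 : ℝ) 1)
    (S : Matrix (Fin 2) (Fin 2) ℝ) (hS : S = covMatrix σ₁ σ₂ ρ)
    (F : ℝ → Matrix (Fin p) (Fin 2) ℝ)
    (hF : ∀ r c, ContDiffOn ℝ 1 (fun s => F s r c) (Set.Icc a b))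
    (M : Matrix (Fin p) (Fin p) ℝ) (hM : M = infoMatrix a b F S) (hMdet : M.det ≠ 0)
    (ε : Fin 2 → ℝ≥0 → Ω → ℝ) (hε : ∀ c, IsBrownianReal (ε c) P)
    (hindep : IndepFun (fun ω u => ε 0 u ω) (fun ω u => ε 1 u ω) P)
    (θ : Fin p → ℝ)
    (Y : ℝ → Ω → Fin 2 → ℝ) (hY : Y = observation F S ε θ)
    (t : Fin (m + 1) → ℝ) (ht : StrictMono t) (ht_first : t 0 = a) (ht_last : t (Fin.last m) = b)
    (Φ : Fin m → Matrix (Fin p) (Fin 2) ℝ)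
    (F' : ℝ → Matrix (Fin p) (Fin 2) ℝ) (hF' : F' = matDeriv a b F)
    (D : Ω → Fin p → ℝ)
    (hD : D = fun ω => blue P a b F S Y ω - discreteEstimator a b F S t Φ Y ω) :
    (∀ r c, IsStochIntegral P (fun u ω => Y u ω c) a b (fun s => (F' s * S⁻¹) r c)
      (stochIntegral P (fun u ω => Y u ω c) a b (fun s => (F' s * S⁻¹) r c))) ∧
    (∀ r q, Integrable (fun ω => D ω r * D ω q) P) ∧
    (Matrix.of fun r q => ∫ ω, D ω r * D ω q ∂P) =
      M⁻¹ *
        (∑ i : Fin m, matIntegral (t i.castSucc) (t i.succ)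
            (fun s => (F' s - Φ i) * S⁻¹ * (F' s - Φ i)ᵀ)
          + ∑ i : Fin m, ∑ j : Fin m,
              matIntegral (t i.castSucc) (t i.succ) (fun s => (F' s - Φ i) * S⁻¹ * (F' s)ᵀ)
                * Matrix.vecMulVec θ θ
                * matIntegral (t j.castSucc) (t j.succ) (fun s => F' s * S⁻¹ * (F' s - Φ j)ᵀ))
        * M⁻¹ := by
  subst hS hM hY hF' hD
  set S := covMatrix σ₁ σ₂ ρ
  have hSpos : S.PosDef := covMatrix_posDef hσ₁ hσ₂ hρ
  have hSt : Sᵀ = S := by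
    rw [← Matrix.conjTranspose_eq_transpose_of_trivial]
    exact hSpos.isHermitian.eq
  have hI : ∀ r c, IsStochIntegral P (fun u ω => observation F S ε θ u ω c) a b
      (fun s => (matDeriv a b F s * S⁻¹) r c)
      (stochIntegral P (fun u ω => observation F S ε θ u ω c) a b
        (fun s => (matDeriv a b F s * S⁻¹) r c)) := by
    intro r c
    obtain ⟨I, -, hI⟩ := exists_isStochIntegral_noise_and_observation ha.le hab hSpos.posSemidef hF
      hε hindep θ c (continuousOn_matDeriv_mul hab hF S⁻¹ r c)
    exact isStochIntegral_stochIntegral hI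
  have hV := memLp_two_integralError (a := a) (b := b) (F := F) (S := S) hε θ
    (weightStep S t ht ht_first ht_last Φ) (fun r c => (hI r c).2.1)
  simp only [blue_sub_discreteEstimator t ht ht_first ht_last]
  refine ⟨hI, fun r q => ?_, ?_⟩
  · have hMV : ∀ r, MemLp (fun ω => ((infoMatrix a b F S)⁻¹ *ᵥ integralError P F S
        (weightStep S t ht ht_first ht_last Φ) (observation F S ε θ) ω) r) 2 P := by
      intro r
      simp only [Matrix.mulVec, dotProduct]
      exact memLp_finsetSum _ fun q _ => (hV q).const_mul _
    exact (hMV r).integrable_mul (hMV q)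
  · rw [integral_mulVec_mul_mulVec _ hV, Matrix.transpose_nonsing_inv, infoMatrix_transpose hSt]
    congr 2
    -- By symmetry of `S⁻¹` the right factors are transposes of the left ones, so the double sum
    -- factors as `W θ θᵀ Wᵀ`, the outer product of the drift `W θ` with itself.
    have hW : ∀ j : Fin m, matIntegral (t j.castSucc) (t j.succ)
        (fun s => matDeriv a b F s * S⁻¹ * (matDeriv a b F s - Φ j)ᵀ) =
        (matIntegral (t j.castSucc) (t j.succ)
          (fun s => (matDeriv a b F s - Φ j) * S⁻¹ * (matDeriv a b F s)ᵀ))ᵀ := by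
      intro j
      rw [transpose_matIntegral]
      simp only [Matrix.transpose_mul, Matrix.transpose_nonsing_inv, hSt,
        Matrix.transpose_transpose, Matrix.mul_assoc]
    simp only [hW, ← Finset.mul_sum, ← Finset.sum_mul, ← Matrix.transpose_sum]
    rw [Matrix.mul_vecMulVec, Matrix.vecMulVec_mul, Matrix.vecMul_transpose]
    ext r q
    rw [Matrix.add_apply, Matrix.vecMulVec_apply,
      sum_matIntegral_mulVec t ht ht_first ht_last Φ hab hF,
      sum_matIntegral_mulVec t ht ht_first ht_last Φ hab hF,
      sum_matIntegral_covariance t ht ht_first ht_last Φ hab hSpos hF, Matrix.of_apply,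
      integral_integralError_mul ha.le hab hSpos.posSemidef hF hε hindep θ, add_comm]
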